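/- Let $\mathfrak A$ be a (not necessarily unital) C*-algebra, let $\mathbb Z_2=\{1,-1\}$, and let $\alpha:\mathbb Z_2\to{}^*\mathrm{Aut}(\mathfrak A)$ be a group homomorphism (so that $(\mathfrak A,\mathbb Z_2,\alpha)$ is a C*-dynamical system). Let $\mathfrak A^{\mathbb Z_2}$ be the *-algebra of all functions $f:\mathbb Z_2\to\mathfrak A$ with pointwise addition and scalar multiplication, the multiplication $$(fg)(s)=\tfrac12\sum_{r\in\mathbb Z_2}f(r)\,\alpha_r\big(g(r^{-1}s)\big)$$ and the involution $f^*(s)=\alpha_s\big(f(s^{-1})^*\big)$. A covariant representation $(\mathcal H,\pi,U)$ consists of a complex Hilbert space $\mathcal H$, a *-homomorphism $\pi:\mathfrak A\to\mathcal L(\mathcal H)$ and a unitary representation $U$ of $\mathbb Z_2$ on $\mathcal H$ such that $\pi(\alpha_s(A))=U_s\pi(A)U_s^*$ for all $s\in\mathbb Z_2$ and $A\in\mathfrak A$; its integrated form is $(\pi\rtimes U)(f)=\frac12\sum_{s\in\mathbb Z_2}\pi(f(s))U_s$. The crossed product $\mathfrak A\rtimes_\alpha\mathbb Z_2$ is the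 C*-algebra obtained by completing $\mathfrak A^{\mathbb Z_2}$ with respect to the universal norm $\|f\|=\sup_{(\mathcal H,\pi,U)}\|(\pi\rtimes U)(f)\|$, the supremum being over all covariant representations. Write $\cong$ for the existence of a *-isomorphism. Then: (a) If $\mathfrak B$ is a C*-algebra such that $\mathfrak B\cong\mathfrak A^{\mathbb Z_2}$ as *-algebras, then $\mathfrak A\rtimes_\alpha\mathbb Z_2\cong\mathfrak B$. (b) $\mathfrak A\rtimes_\alpha\mathbb Z_2\cong\widehat{\mathfrak A}$, where $$\widehat{\mathfrak A}=\left\{\begin{bmatrix}A&B\\ \alpha_{-1}(B)&\alpha_{-1}(A)\end{bmatrix}\;\middle|\;A,B\in\mathfrak A\right\}$$ is a C*-subalgebra of the C*-algebra $\mathfrak A^{2\times2}$ of $2\times2$ matrices over $\mathfrak A$. -/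

import Mathlib

universe u v

noncomputable section

namespace Z2Crossed

variable {A : Type u} [NonUnitalCStarAlgebra A]

/-! The group `ℤ₂ = {1, -1}` is `ℤˣ`, and an action of `ℤ₂` on the C*-algebra `A` by
*-automorphisms is a group homomorphism `α : ℤˣ →* (A ≃⋆ₐ[ℂ] A)`; it is automatically strongly
continuous because `ℤ₂` is finite and discrete. -/

lemma sum_units {M : Type*} [AddCommMonoid M] (f : ℤˣ → M) : ∑ s, f s = f 1 + f (-1) := by
  rw [UnitsInt.univ]
  exact Finset.sum_pair (by decide)

lemma act_one (α : ℤˣ →* (A ≃⋆ₐ[ℂ] A)) (a : A) : α 1 a = a := by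
  rw [map_one]; rfl

lemma act_act (α : ℤˣ →* (A ≃⋆ₐ[ℂ] A)) (r s : ℤˣ) (a : A) : α r (α s a) = α (r * s) a := by
  rw [map_mul]; rfl

lemma neg_one_inv : (-1 : ℤˣ)⁻¹ = -1 := rfl

/-- The complex vector space `A^{ℤ₂}` of all functions `ℤ₂ → A`. It depends on `α` through the
multiplication and the involution that it carries below. -/
def ConvAlg (_α : ℤˣ →* (A ≃⋆ₐ[ℂ] A)) : Type u := ℤˣ → A

namespace ConvAlg

variable (α : ℤˣ →* (A ≃⋆ₐ[ℂ] A))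

instance instAddCommGroup : AddCommGroup (ConvAlg α) := inferInstanceAs (AddCommGroup (ℤˣ → A))

instance instModule : Module ℂ (ConvAlg α) := inferInstanceAs (Module ℂ (ℤˣ → A))

/-- The convolution product with respect to the normalized Haar measure of `ℤ₂`. -/
instance instMul : Mul (ConvAlg α) where
  mul f g := fun s => (1 / 2 : ℂ) • ∑ r : ℤˣ, f r * α r (g (r⁻¹ * s))

/-- The involution (the group `ℤ₂` is unimodular). -/
instance instStar : Star (ConvAlg α) where
  star f := fun s => α s (star (f s⁻¹))

variable {α}

@[ext] lemma ext {f g : ConvAlg α} (h : ∀ s : ℤˣ, f s = g s) : f = g := funext h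

@[simp] lemma add_apply (f g : ConvAlg α) (s : ℤˣ) : (f + g) s = f s + g s := rfl

@[simp] lemma zero_apply (s : ℤˣ) : (0 : ConvAlg α) s = 0 := rfl

@[simp] lemma neg_apply (f : ConvAlg α) (s : ℤˣ) : (-f) s = -f s := rfl

@[simp] lemma smul_apply (c : ℂ) (f : ConvAlg α) (s : ℤˣ) : (c • f) s = c • f s := rfl

lemma mul_apply (f g : ConvAlg α) (s : ℤˣ) :
    (f * g) s = (1 / 2 : ℂ) • ∑ r : ℤˣ, f r * α r (g (r⁻¹ * s)) := rfl

lemma star_apply (f : ConvAlg α) (s : ℤˣ) : (star f) s = α s (star (f s⁻¹)) := rfl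

instance instNonUnitalRing : NonUnitalRing (ConvAlg α) where
  left_distrib f g h := by
    ext s
    simp [mul_apply, mul_add, Finset.sum_add_distrib]
  right_distrib f g h := by
    ext s
    simp [mul_apply, add_mul, Finset.sum_add_distrib]
  zero_mul f := by ext s; simp [mul_apply]
  mul_zero f := by ext s; simp [mul_apply]
  mul_assoc f g h := by
    ext s
    simp only [mul_apply, Finset.smul_sum, Finset.sum_mul, Finset.mul_sum, map_sum, map_smul,
      map_mul, act_act, smul_mul_assoc, mul_smul_comm]
    rw [Finset.sum_comm]
    refine Finset.sum_congr rfl fun r _ => ?_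
    refine Fintype.sum_equiv (Equiv.mulLeft r⁻¹) _ _ fun t => ?_
    simp only [Equiv.coe_mulLeft, mul_inv_rev, inv_inv, mul_assoc, StarAlgEquiv.mul_apply,
      act_act, mul_inv_cancel_left]

instance instStarRing : StarRing (ConvAlg α) where
  star_involutive f := by
    ext s
    simp [star_apply, ← map_star, act_act]
  star_mul f g := by
    ext s
    simp only [star_apply, mul_apply, star_smul, star_sum, star_mul, map_smul, map_sum, map_mul,
      ← map_star, act_act]
    have h : star (1 / 2 : ℂ) = 1 / 2 := by simp
    rw [h]
    congr 1
    refine Fintype.sum_equiv (Equiv.mulLeft s) _ _ fun t => ?_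
    simp only [Equiv.coe_mulLeft, mul_inv_rev, inv_inv, mul_assoc, StarAlgEquiv.mul_apply,
      act_act, mul_inv_cancel, inv_mul_cancel, mul_one]
  star_add f g := by ext s; simp [star_apply]

instance instStarModule : StarModule ℂ (ConvAlg α) where
  star_smul c f := by ext s; simp [star_apply]

instance instIsScalarTower : IsScalarTower ℂ (ConvAlg α) (ConvAlg α) where
  smul_assoc c f g := by
    ext s
    simp only [smul_eq_mul, mul_apply, smul_apply, smul_mul_assoc, ← Finset.smul_sum]
    rw [smul_comm]

instance instSMulCommClass : SMulCommClass ℂ (ConvAlg α) (ConvAlg α) where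
  smul_comm c f g := by
    ext s
    simp only [smul_eq_mul, mul_apply, smul_apply, map_smul, mul_smul_comm, ← Finset.smul_sum]
    rw [smul_comm]

end ConvAlg

/-- A covariant representation `(H, π, U)` of `(A, ℤ₂, α)`. -/
structure CovRep (α : ℤˣ →* (A ≃⋆ₐ[ℂ] A)) where
  /-- the complex Hilbert space -/
  H : Type u
  [normedAddCommGroup : NormedAddCommGroup H]
  [innerProductSpace : InnerProductSpace ℂ H]
  [completeSpace : CompleteSpace H]
  /-- the representation of the C*-algebra -/
  π : A →⋆ₙₐ[ℂ] (H →L[ℂ] H)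
  /-- the unitary representation of `ℤ₂` -/
  U : ℤˣ →* unitary (H →L[ℂ] H)
  covariant : ∀ (s : ℤˣ) (a : A),
    π (α s a) = (U s : H →L[ℂ] H) * π a * star (U s : H →L[ℂ] H)

attribute [instance] CovRep.normedAddCommGroup CovRep.innerProductSpace CovRep.completeSpace

namespace CovRep

variable {α : ℤˣ →* (A ≃⋆ₐ[ℂ] A)} (ρ : CovRep α)

lemma U_mul_π (s : ℤˣ) (a : A) :
    (ρ.U s : ρ.H →L[ℂ] ρ.H) * ρ.π a = ρ.π (α s a) * (ρ.U s : ρ.H →L[ℂ] ρ.H) := by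
  rw [ρ.covariant, mul_assoc, Unitary.coe_star_mul_self, mul_one]

lemma star_U (s : ℤˣ) :
    star (ρ.U s : ρ.H →L[ℂ] ρ.H) = (ρ.U s⁻¹ : ρ.H →L[ℂ] ρ.H) := by
  rw [map_inv]; rfl

/-- The integrated form `π ⋊ U` of a covariant representation, with respect to the normalized
Haar measure of `ℤ₂`. -/
def integratedForm : ConvAlg α →⋆ₙₐ[ℂ] (ρ.H →L[ℂ] ρ.H) where
  toFun f := (1 / 2 : ℂ) • ∑ s : ℤˣ, ρ.π (f s) * (ρ.U s : ρ.H →L[ℂ] ρ.H)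
  map_smul' c f := by
    simp only [ConvAlg.smul_apply, map_smul, smul_mul_assoc, ← Finset.smul_sum,
      MonoidHom.id_apply]
    rw [smul_comm]
  map_zero' := by simp
  map_add' f g := by
    simp [add_mul, Finset.sum_add_distrib]
  map_mul' f g := by
    simp only [ConvAlg.mul_apply, Finset.smul_sum, Finset.sum_mul, Finset.mul_sum, map_sum,
      map_smul, map_mul, smul_mul_assoc, mul_smul_comm]
    rw [Finset.sum_comm]
    conv_rhs => rw [Finset.sum_comm]
    refine Finset.sum_congr rfl fun r _ => ?_
    refine Fintype.sum_equiv (Equiv.mulLeft r⁻¹) _ _ fun t => ?_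
    have h : (ρ.U t : ρ.H →L[ℂ] ρ.H) = (ρ.U r : ρ.H →L[ℂ] ρ.H) * (ρ.U (r⁻¹ * t)) := by
      rw [← Submonoid.coe_mul, ← map_mul, mul_inv_cancel_left]
    simp only [Equiv.coe_mulLeft]
    rw [h, mul_assoc, ← mul_assoc (ρ.π (α r _)), ← U_mul_π]
    simp only [mul_assoc]
  map_star' f := by
    have h : star (1 / 2 : ℂ) = 1 / 2 := by simp
    simp only [ConvAlg.star_apply, star_smul, star_sum, star_mul, h, star_U, ← map_star, U_mul_π]
    congr 1

lemma integratedForm_apply (f : ConvAlg α) :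
    ρ.integratedForm f = (1 / 2 : ℂ) • ∑ s : ℤˣ, ρ.π (f s) * (ρ.U s : ρ.H →L[ℂ] ρ.H) := rfl

lemma norm_integratedForm_le (f : ConvAlg α) :
    ‖ρ.integratedForm f‖ ≤ (1 / 2 : ℝ) * ∑ s : ℤˣ, ‖f s‖ := by
  rw [integratedForm_apply, norm_smul]
  have h : ‖(1 / 2 : ℂ)‖ = 1 / 2 := by simp
  rw [h]
  gcongr
  refine (norm_sum_le _ _).trans (Finset.sum_le_sum fun s _ => ?_)
  rw [CStarRing.norm_mul_coe_unitary]
  exact NonUnitalStarAlgHom.norm_apply_le ρ.π (f s)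

end CovRep

namespace ConvAlg

variable {α : ℤˣ →* (A ≃⋆ₐ[ℂ] A)}

/-- The universal norm: the supremum of `‖(π ⋊ U)(f)‖` over all covariant representations. -/
def univNorm (f : ConvAlg α) : ℝ := ⨆ ρ : CovRep α, ‖ρ.integratedForm f‖

lemma bddAbove_univNorm (f : ConvAlg α) :
    BddAbove (Set.range fun ρ : CovRep α => ‖ρ.integratedForm f‖) := by
  refine ⟨(1 / 2 : ℝ) * ∑ s : ℤˣ, ‖f s‖, ?_⟩
  rintro _ ⟨ρ, rfl⟩
  exact ρ.norm_integratedForm_le f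

lemma le_univNorm (ρ : CovRep α) (f : ConvAlg α) : ‖ρ.integratedForm f‖ ≤ univNorm f :=
  le_ciSup (bddAbove_univNorm f) ρ

lemma univNorm_nonneg (f : ConvAlg α) : 0 ≤ univNorm f :=
  Real.iSup_nonneg fun _ => norm_nonneg _

lemma univNorm_le {f : ConvAlg α} {c : ℝ} (hc : 0 ≤ c)
    (h : ∀ ρ : CovRep α, ‖ρ.integratedForm f‖ ≤ c) : univNorm f ≤ c :=
  Real.iSup_le h hc

instance instSeminormedAddCommGroup : SeminormedAddCommGroup (ConvAlg α) :=
  AddGroupSeminorm.toSeminormedAddCommGroup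
    { toFun := univNorm
      map_zero' := by simp [univNorm]
      add_le' := fun f g => by
        refine univNorm_le (add_nonneg (univNorm_nonneg f) (univNorm_nonneg g)) fun ρ => ?_
        rw [map_add]
        exact (norm_add_le _ _).trans (add_le_add (le_univNorm ρ f) (le_univNorm ρ g))
      neg' := fun f => by simp [univNorm] }

lemma norm_def (f : ConvAlg α) : ‖f‖ = ⨆ ρ : CovRep α, ‖ρ.integratedForm f‖ := rfl

instance instNonUnitalSeminormedRing : NonUnitalSeminormedRing (ConvAlg α) where
  __ := instSeminormedAddCommGroup
  __ := instNonUnitalRing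
  norm_mul_le f g := by
    refine univNorm_le (mul_nonneg (univNorm_nonneg f) (univNorm_nonneg g)) fun ρ => ?_
    rw [map_mul]
    exact (norm_mul_le _ _).trans
      (mul_le_mul (le_univNorm ρ f) (le_univNorm ρ g) (norm_nonneg _) (univNorm_nonneg f))

instance instNormedSpace : NormedSpace ℂ (ConvAlg α) where
  norm_smul_le c f := by
    refine univNorm_le (mul_nonneg (norm_nonneg c) (univNorm_nonneg f)) fun ρ => ?_
    rw [map_smul, norm_smul]
    exact mul_le_mul_of_nonneg_left (le_univNorm ρ f) (norm_nonneg c)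

lemma norm_star (f : ConvAlg α) : ‖star f‖ = ‖f‖ := by
  simp only [norm_def, map_star, _root_.norm_star]

lemma norm_mul_self_le (f : ConvAlg α) : ‖f‖ * ‖f‖ ≤ ‖star f * f‖ := by
  have h : ‖f‖ ≤ √‖star f * f‖ := by
    refine univNorm_le (Real.sqrt_nonneg _) fun ρ => Real.le_sqrt_of_sq_le ?_
    rw [sq, ← CStarRing.norm_star_mul_self, ← map_star, ← map_mul]
    exact le_univNorm ρ _
  calc ‖f‖ * ‖f‖ ≤ √‖star f * f‖ * √‖star f * f‖ := by gcongr
    _ = ‖star f * f‖ := Real.mul_self_sqrt (norm_nonneg _)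

lemma isometry_star : Isometry (star : ConvAlg α → ConvAlg α) :=
  AddMonoidHomClass.isometry_of_norm (starAddEquiv : ConvAlg α ≃+ ConvAlg α) norm_star

end ConvAlg

/-- The crossed product `A ⋊_α ℤ₂`: the (Hausdorff) completion of the *-algebra `A^{ℤ₂}` with
respect to the universal norm. -/
def CrossedProduct (α : ℤˣ →* (A ≃⋆ₐ[ℂ] A)) : Type u := UniformSpace.Completion (ConvAlg α)

namespace CrossedProduct

open UniformSpace

variable {α : ℤˣ →* (A ≃⋆ₐ[ℂ] A)}

instance instNormedAddCommGroup : NormedAddCommGroup (CrossedProduct α) :=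
  inferInstanceAs (NormedAddCommGroup (Completion (ConvAlg α)))

instance instNormedSpace : NormedSpace ℂ (CrossedProduct α) :=
  inferInstanceAs (NormedSpace ℂ (Completion (ConvAlg α)))

instance instCompleteSpace : CompleteSpace (CrossedProduct α) :=
  inferInstanceAs (CompleteSpace (Completion (ConvAlg α)))

/-- The canonical map `E : A^{ℤ₂} → A ⋊_α ℤ₂`. -/
def ι : ConvAlg α →ₗᵢ[ℂ] CrossedProduct α := Completion.toComplₗᵢ

lemma isDenseInducing_ι : IsDenseInducing (ι : ConvAlg α → CrossedProduct α) :=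
  Completion.isDenseInducing_coe

lemma denseRange_ι : DenseRange (ι : ConvAlg α → CrossedProduct α) := isDenseInducing_ι.dense

/-- The multiplication is the continuous extension of the multiplication of `A^{ℤ₂}`. -/
instance instMul : Mul (CrossedProduct α) where
  mul x y := (isDenseInducing_ι.prodMap isDenseInducing_ι).extend
    (fun p : ConvAlg α × ConvAlg α => (ι (p.1 * p.2) : CrossedProduct α)) (x, y)

/-- The involution is the continuous extension of the involution of `A^{ℤ₂}`. -/
instance instStar : Star (CrossedProduct α) where
  star x := isDenseInducing_ι.extend (fun f : ConvAlg α => (ι (star f) : CrossedProduct α)) x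

lemma ι_mul (f g : ConvAlg α) : (ι (f * g) : CrossedProduct α) = ι f * ι g :=
  ((isDenseInducing_ι.prodMap isDenseInducing_ι).extend_eq
    (ι.continuous.comp continuous_mul) (f, g)).symm

lemma ι_star (f : ConvAlg α) : (ι (star f) : CrossedProduct α) = star (ι f) :=
  (isDenseInducing_ι.extend_eq
    (ι.continuous.comp ConvAlg.isometry_star.continuous) f).symm

instance instContinuousMul : ContinuousMul (CrossedProduct α) where
  continuous_mul := by
    let e : ConvAlg α →+ CrossedProduct α := (ι : ConvAlg α →ₗᵢ[ℂ] CrossedProduct α)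
    let m := (AddMonoidHom.mul : ConvAlg α →+ ConvAlg α →+ ConvAlg α).compr₂ e
    have hm : Continuous fun p : ConvAlg α × ConvAlg α => m p.1 p.2 :=
      ι.continuous.comp continuous_mul
    have di : IsDenseInducing e := isDenseInducing_ι
    exact (di.extend_Z_bilin di hm :)

instance instContinuousStar : ContinuousStar (CrossedProduct α) where
  continuous_star := by
    have h : UniformContinuous (fun f : ConvAlg α => (ι (star f) : CrossedProduct α)) :=
      ι.isometry.uniformContinuous.comp ConvAlg.isometry_star.uniformContinuous
    exact (uniformContinuous_uniformly_extend ι.isometry.isUniformInducing denseRange_ι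
      h).continuous

instance instNonUnitalRing : NonUnitalRing (CrossedProduct α) where
  zero_mul x := by
    refine denseRange_ι.induction_on x (isClosed_eq (by fun_prop) (by fun_prop)) fun f => ?_
    rw [← map_zero ι, ← ι_mul, zero_mul]
  mul_zero x := by
    refine denseRange_ι.induction_on x (isClosed_eq (by fun_prop) (by fun_prop)) fun f => ?_
    rw [← map_zero ι, ← ι_mul, mul_zero]
  mul_assoc x y z := by
    refine denseRange_ι.induction_on₃ (isClosed_eq (by fun_prop) (by fun_prop))
      (fun f g h => ?_) x y z
    simp only [← ι_mul, mul_assoc]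
  left_distrib x y z := by
    refine denseRange_ι.induction_on₃ (isClosed_eq (by fun_prop) (by fun_prop))
      (fun f g h => ?_) x y z
    simp only [← ι_mul, ← map_add, mul_add]
  right_distrib x y z := by
    refine denseRange_ι.induction_on₃ (isClosed_eq (by fun_prop) (by fun_prop))
      (fun f g h => ?_) x y z
    simp only [← ι_mul, ← map_add, add_mul]

instance instNonUnitalNormedRing : NonUnitalNormedRing (CrossedProduct α) where
  __ := instNormedAddCommGroup
  __ := instNonUnitalRing
  norm_mul_le x y := by
    refine denseRange_ι.induction_on₂ (p := fun x y : CrossedProduct α => ‖x * y‖ ≤ ‖x‖ * ‖y‖)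
      (isClosed_le (by fun_prop) (by fun_prop)) (fun f g => ?_) x y
    simp only [← ι_mul, LinearIsometry.norm_map]
    exact norm_mul_le f g

instance instStarRing : StarRing (CrossedProduct α) where
  star_involutive x := by
    refine denseRange_ι.induction_on x (isClosed_eq (by fun_prop) (by fun_prop)) fun f => ?_
    rw [← ι_star, ← ι_star, star_star]
  star_mul x y := by
    refine denseRange_ι.induction_on₂ (isClosed_eq (by fun_prop) (by fun_prop))
      (fun f g => ?_) x y
    simp only [← ι_star, ← ι_mul, star_mul]
  star_add x y := by
    refine denseRange_ι.induction_on₂ (isClosed_eq (by fun_prop) (by fun_prop))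
      (fun f g => ?_) x y
    simp only [← ι_star, ← map_add, star_add]

instance instCStarRing : CStarRing (CrossedProduct α) where
  norm_mul_self_le x := by
    refine denseRange_ι.induction_on x (isClosed_le (by fun_prop) (by fun_prop)) fun f => ?_
    simp only [← ι_star, ← ι_mul, LinearIsometry.norm_map]
    exact ConvAlg.norm_mul_self_le f

lemma smul_mul_aux (c : ℂ) (x y : CrossedProduct α) : (c • x) * y = c • (x * y) := by
  refine denseRange_ι.induction_on₂
    (p := fun x y : CrossedProduct α => (c • x) * y = c • (x * y))
    (isClosed_eq ((continuous_fst.const_smul c).mul continuous_snd)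
      ((continuous_fst.mul continuous_snd).const_smul c)) (fun f g => ?_) x y
  rw [← ι_mul, ← LinearIsometry.map_smul, ← LinearIsometry.map_smul, ← ι_mul, smul_mul_assoc]

lemma mul_smul_aux (c : ℂ) (x y : CrossedProduct α) : x * (c • y) = c • (x * y) := by
  refine denseRange_ι.induction_on₂
    (p := fun x y : CrossedProduct α => x * (c • y) = c • (x * y))
    (isClosed_eq (continuous_fst.mul (continuous_snd.const_smul c))
      ((continuous_fst.mul continuous_snd).const_smul c)) (fun f g => ?_) x y
  rw [← ι_mul, ← LinearIsometry.map_smul, ← LinearIsometry.map_smul, ← ι_mul, mul_smul_comm]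

lemma star_smul_aux (c : ℂ) (x : CrossedProduct α) : star (c • x) = star c • star x := by
  refine denseRange_ι.induction_on
    (p := fun x : CrossedProduct α => star (c • x) = star c • star x) x
    (isClosed_eq (continuous_id.const_smul c).star (continuous_id.star.const_smul (star c)))
    fun f => ?_
  rw [← ι_star, ← LinearIsometry.map_smul, ← LinearIsometry.map_smul, ← ι_star, star_smul]

/-- The crossed product is a C*-algebra. -/
instance instNonUnitalCStarAlgebra : NonUnitalCStarAlgebra (CrossedProduct α) where
  smul_assoc c x y := smul_mul_aux c x y
  smul_comm c x y := (mul_smul_aux c x y).symm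
  star_smul c x := star_smul_aux c x

end CrossedProduct

/-- The *-subalgebra `Â` of the C*-algebra of `2 × 2` matrices over `A`, consisting of the matrices
`[[a, b], [α₋₁(b), α₋₁(a)]]`. -/
def hatAlg (α : ℤˣ →* (A ≃⋆ₐ[ℂ] A)) :
    NonUnitalStarSubalgebra ℂ (CStarMatrix (Fin 2) (Fin 2) A) where
  carrier := {X | ∃ a b : A, X = CStarMatrix.ofMatrix !![a, b; α (-1) b, α (-1) a]}
  zero_mem' := ⟨0, 0, by ext i j; fin_cases i <;> fin_cases j <;> simp⟩
  add_mem' := by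
    rintro _ _ ⟨a, b, rfl⟩ ⟨c, d, rfl⟩
    exact ⟨a + c, b + d, by ext i j; fin_cases i <;> fin_cases j <;> simp⟩
  smul_mem' := by
    rintro c _ ⟨a, b, rfl⟩
    exact ⟨c • a, c • b, by ext i j; fin_cases i <;> fin_cases j <;> simp⟩
  mul_mem' := by
    rintro _ _ ⟨a, b, rfl⟩ ⟨c, d, rfl⟩
    refine ⟨a * c + b * α (-1) d, a * d + b * α (-1) c, ?_⟩
    ext i j
    fin_cases i <;> fin_cases j <;>
      simp [CStarMatrix.mul_apply, Fin.sum_univ_two, act_act, add_comm]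
  star_mem' := by
    rintro _ ⟨a, b, rfl⟩
    refine ⟨star a, α (-1) (star b), ?_⟩
    ext i j
    fin_cases i <;> fin_cases j <;>
      simp [CStarMatrix.star_apply, ← map_star, act_act]

lemma mem_hatAlg {α : ℤˣ →* (A ≃⋆ₐ[ℂ] A)} {X : CStarMatrix (Fin 2) (Fin 2) A} :
    X ∈ hatAlg α ↔ ∃ a b : A, X = CStarMatrix.ofMatrix !![a, b; α (-1) b, α (-1) a] := Iff.rfl

/-- `Â` is closed in the C*-algebra of `2 × 2` matrices, hence a C*-subalgebra. -/
instance isClosed_hatAlg (α : ℤˣ →* (A ≃⋆ₐ[ℂ] A)) :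
    IsClosed (hatAlg α : Set (CStarMatrix (Fin 2) (Fin 2) A)) := by
  have h : (hatAlg α : Set (CStarMatrix (Fin 2) (Fin 2) A)) =
      {X | X 1 0 = α (-1) (X 0 1)} ∩ {X | X 1 1 = α (-1) (X 0 0)} := by
    ext X
    constructor
    · rintro ⟨a, b, rfl⟩
      simp
    · rintro ⟨h₁, h₂⟩
      refine ⟨X 0 0, X 0 1, ?_⟩
      change X 1 0 = _ at h₁
      change X 1 1 = _ at h₂
      ext i j
      fin_cases i <;> fin_cases j <;> simp [h₁, h₂]
  have hα : Continuous (α (-1)) := (NonUnitalStarAlgHom.isometry (F := A ≃⋆ₐ[ℂ] A) (α (-1))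
    (α (-1)).injective).continuous
  have hX (i j : Fin 2) : Continuous fun X : CStarMatrix (Fin 2) (Fin 2) A => X i j :=
    (continuous_apply j).comp (continuous_apply i : Continuous fun X : Fin 2 → Fin 2 → A => X i)
  rw [h]
  exact (isClosed_eq (hX 1 0) (hα.comp (hX 0 1))).inter
    (isClosed_eq (hX 1 1) (hα.comp (hX 0 0)))

/-- `Â` is a C*-algebra with the norm of the C*-algebra of `2 × 2` matrices over `A`. -/
instance instNonUnitalCStarAlgebraHatAlg [PartialOrder A] [StarOrderedRing A]
    (α : ℤˣ →* (A ≃⋆ₐ[ℂ] A)) : NonUnitalCStarAlgebra (hatAlg α) :=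
  NonUnitalStarSubalgebra.nonUnitalCStarAlgebra (hatAlg α) (h_closed := isClosed_hatAlg α)

end Z2Crossed

end

/-! The group is finite, so completing `A^{ℤ₂}` changes nothing: the universal norm is equivalent to
the supremum norm, for which the functions `ℤˣ → A` are already complete. The upper bound
`norm_le_sum` is the triangle inequality.

The lower bound `norm_apply_le` needs one good covariant representation. Over the unitization, `a ↦
diag(a, α₋₁(a))` and the flip matrix satisfy the covariance relation, and the integrated form of `f`
is half the matrix with rows `(f(1), f(-1))` and `(α₋₁(f(-1)), α₋₁(f(1)))`. A GNS representation
chosen to preserve the norm of this matrix (`exists_starAlgHom_norm_le`) turns the pair into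
operators on a Hilbert space, and a matrix norm dominates the norms of the entries.

Hence `ι` is a bijective *-homomorphism. Part (a) follows by composition, and part (b) because the
same half-matrix formula is an algebraic *-isomorphism onto `Â`. -/

namespace CStarAlgebra

open scoped ComplexOrder

/-! ### States on unital C*-algebras -/

section State

variable {B : Type*} [CStarAlgebra B]

/-- A contractive unital functional on a unital C*-algebra is real on self-adjoint elements. -/
lemma im_apply_eq_zero_of_norm_le_one {g : StrongDual ℂ B} (hg : ‖g‖ ≤ 1) (h1 : g 1 = 1)
    {x : B} (hx : IsSelfAdjoint x) : (g x).im = 0 := by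
  have : Nontrivial B := ⟨1, 0, fun h => by simp [h] at h1⟩
  -- Shift `x` by `it`: self-adjointness gives `y*y = x² + t²`, while the shift moves the imaginary
  -- part of `g x` by exactly `t`.
  have key (t : ℝ) : ((g x).im + t) ^ 2 ≤ ‖x‖ ^ 2 + t ^ 2 := by
    let y : B := x + (Complex.I * t) • (1 : B)
    have hgy : g y = g x + Complex.I * t := by simp [y, h1]
    have hyy : star y * y = x * x + ((t : ℂ) ^ 2) • (1 : B) := by
      simp only [y, star_add, hx.star_eq, star_smul, star_one, add_mul, mul_add, smul_mul_assoc,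
        mul_smul_comm, one_mul, mul_one, star_mul', Complex.star_def, Complex.conj_I,
        Complex.conj_ofReal]
      rw [smul_add, smul_smul]
      have h : Complex.I * (t : ℂ) * (-Complex.I * (t : ℂ)) = (t : ℂ) ^ 2 := by
        linear_combination (-(t : ℂ) ^ 2) * Complex.I_sq
      rw [h]
      module
    have hny : ‖y‖ ^ 2 ≤ ‖x‖ ^ 2 + t ^ 2 := by
      rw [sq, ← CStarRing.norm_star_mul_self, hyy]
      refine (norm_add_le _ _).trans (add_le_add ?_ ?_)
      · rw [sq]; exact norm_mul_le x x
      · simp [norm_smul]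
    calc ((g x).im + t) ^ 2 = (g y).im ^ 2 := by simp [hgy]
      _ ≤ ‖g y‖ ^ 2 := by
        rw [← sq_abs]; gcongr; exact Complex.abs_im_le_norm _
      _ ≤ ‖y‖ ^ 2 := by
        gcongr
        exact (g.le_of_opNorm_le hg y).trans_eq (one_mul _)
      _ ≤ _ := hny
  by_contra h
  -- Expanding `key` leaves `(Im g x)² + 2t Im g x ≤ ‖x‖²`; this `t` makes the linear term equal to
  -- `‖x‖² + 1`.
  have h3 := key ((‖x‖ ^ 2 + 1) / (2 * (g x).im))
  have h4 : ((g x).im + (‖x‖ ^ 2 + 1) / (2 * (g x).im)) ^ 2 =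
      (g x).im ^ 2 + (‖x‖ ^ 2 + 1) + ((‖x‖ ^ 2 + 1) / (2 * (g x).im)) ^ 2 := by
    field_simp; ring
  nlinarith [sq_nonneg (g x).im]

variable [PartialOrder B] [StarOrderedRing B]

/-- A contractive unital functional on a unital C*-algebra is positive. -/
lemma apply_nonneg_of_norm_le_one {g : StrongDual ℂ B} (hg : ‖g‖ ≤ 1) (h1 : g 1 = 1)
    {x : B} (hx : 0 ≤ x) : 0 ≤ g x := by
  have him := im_apply_eq_zero_of_norm_le_one hg h1 (IsSelfAdjoint.of_nonneg hx)
  refine Complex.nonneg_iff.mpr ⟨?_, him.symm⟩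
  -- Since `0 ≤ ‖x‖ - x ≤ ‖x‖`, the value `g x` lies within `‖x‖` of the number `‖x‖`, so its real
  -- part is nonnegative.
  have h2 : ‖algebraMap ℝ B ‖x‖ - x‖ ≤ ‖x‖ := by
    have h3 : x ≤ algebraMap ℝ B ‖x‖ := (IsSelfAdjoint.of_nonneg hx).le_algebraMap_norm_self
    rw [norm_le_iff_le_algebraMap _ (norm_nonneg x) (sub_nonneg.mpr h3)]
    exact sub_le_self _ hx
  have h4 : g (algebraMap ℝ B ‖x‖ - x) = (‖x‖ : ℂ) - g x := by
    rw [map_sub, Algebra.algebraMap_eq_smul_one, ← Complex.coe_smul, map_smul, h1]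
    simp
  have h5 : ‖(‖x‖ : ℂ) - g x‖ ≤ ‖x‖ := by
    rw [← h4]
    exact (g.le_of_opNorm_le hg _).trans (by rwa [one_mul])
  have h6 := (Complex.re_le_norm _).trans h5
  simp at h6
  exact h6

/-- For positive elements the norm is the least scalar upper bound, and adding `1` shifts such
bounds by `1`. -/
lemma norm_one_add_of_nonneg [Nontrivial B] {b : B} (hb : 0 ≤ b) : ‖1 + b‖ = 1 + ‖b‖ := by
  have h0 : (0 : B) ≤ 1 := zero_le_one
  refine le_antisymm ((norm_add_le _ _).trans (by simp)) ?_
  have h1 : (1 : ℝ) ≤ ‖1 + b‖ := by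
    simpa using norm_le_norm_of_nonneg_of_le h0 (le_add_of_nonneg_right hb)
  have h2 : 1 + b ≤ algebraMap ℝ B ‖1 + b‖ :=
    (IsSelfAdjoint.of_nonneg (add_nonneg h0 hb)).le_algebraMap_norm_self
  have h3 : ‖b‖ ≤ ‖1 + b‖ - 1 := by
    rw [norm_le_iff_le_algebraMap _ (sub_nonneg.mpr h1) hb, map_sub, map_one]
    exact le_sub_iff_add_le'.mpr h2
  linarith

/-- Every positive element of a unital C*-algebra attains its norm at a state. -/
lemma exists_positiveLinearMap_apply_eq_norm [Nontrivial B] {b : B} (hb : 0 ≤ b) :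
    ∃ φ : B →ₚ[ℂ] ℂ, φ 1 = 1 ∧ φ b = ‖b‖ := by
  -- Norming `1 + b` instead of `b` forces `g 1 = 1` as well as `g b = ‖b‖`: the bounds `1` and
  -- `‖b‖` on the two values must both be attained for their sum to be `1 + ‖b‖`.
  obtain ⟨g, hg, hgb⟩ := exists_dual_vector'' ℂ (1 + b)
  have hn := norm_one_add_of_nonneg hb
  rw [hn, map_add] at hgb
  push_cast at hgb
  have n1 : ‖g 1‖ ≤ 1 := (g.le_of_opNorm_le hg 1).trans (by simp)
  have n2 : ‖g b‖ ≤ ‖b‖ := (g.le_of_opNorm_le hg b).trans (by simp)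
  have hre : (g 1).re + (g b).re = 1 + ‖b‖ := by simpa using congrArg Complex.re hgb
  have r1 := (Complex.re_le_norm (g 1)).trans n1
  have r2 := (Complex.re_le_norm (g b)).trans n2
  have h1 : g 1 = 1 := by
    have e : (g 1).re = 1 := by linarith
    have h := Complex.sq_norm_sub_sq_re (g 1)
    rw [e] at h
    refine Complex.ext e (pow_eq_zero_iff two_ne_zero |>.mp (le_antisymm ?_ (sq_nonneg _)))
    nlinarith [norm_nonneg (g 1)]
  refine ⟨.mk₀ g.toLinearMap fun x hx => apply_nonneg_of_norm_le_one hg h1 hx, h1, ?_⟩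
  change g b = _
  rw [h1] at hgb
  exact add_left_cancel hgb

end State

/-! ### Norm-preserving GNS representations -/

/-- For every element of a unital C*-algebra there is a representation on a Hilbert space that
preserves the norm of that element. -/
lemma exists_starAlgHom_norm_le {B : Type u} [CStarAlgebra B] (b : B) :
    ∃ (H : Type u) (_ : NormedAddCommGroup H) (_ : InnerProductSpace ℂ H) (_ : CompleteSpace H)
      (σ : B →⋆ₐ[ℂ] (H →L[ℂ] H)), ‖b‖ ≤ ‖σ b‖ := by
  let _ : PartialOrder B := CStarAlgebra.spectralOrder B
  have : StarOrderedRing B := CStarAlgebra.spectralOrderedRing B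
  obtain hB | hB := subsingleton_or_nontrivial B
  · obtain rfl : b = 0 := Subsingleton.elim _ _
    have φ : B →ₚ[ℂ] ℂ := 0
    exact ⟨φ.GNS, inferInstance, inferInstance, inferInstance, φ.gnsStarAlgHom, by simp⟩
  obtain ⟨φ, h1, hb⟩ := exists_positiveLinearMap_apply_eq_norm (star_mul_self_nonneg b)
  refine ⟨φ.GNS, inferInstance, inferInstance, inferInstance, φ.gnsStarAlgHom, ?_⟩
  -- The class of `1` is a unit vector `ξ` because `φ 1 = 1`, and `‖σ(b)ξ‖² = φ(b*b) = ‖b‖²`.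
  have hξ : ‖((φ.toPreGNS 1 : φ.PreGNS) : φ.GNS)‖ = 1 := by
    rw [UniformSpace.Completion.norm_coe, φ.preGNS_norm_def]
    simp [h1]
  have hbξ : ‖φ.gnsStarAlgHom b ((φ.toPreGNS 1 : φ.PreGNS) : φ.GNS)‖ = ‖b‖ := by
    change ‖φ.gnsNonUnitalStarAlgHom b _‖ = _
    rw [PositiveLinearMap.gnsNonUnitalStarAlgHom_apply_coe, UniformSpace.Completion.norm_coe,
      φ.preGNS_norm_def]
    simp [hb, CStarRing.norm_star_mul_self]
  calc ‖b‖ = _ := hbξ.symm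
    _ ≤ _ := ContinuousLinearMap.le_opNorm _ _
    _ = _ := by rw [hξ, mul_one]

end CStarAlgebra

/-! ### The matrix model as a covariant representation -/

noncomputable section

namespace Z2Crossed

variable {A : Type u} [NonUnitalCStarAlgebra A]

/-- The unit and the flip of `ℂ²`, as a unitary representation of `ℤ₂` by `2 × 2` matrices over a
unital *-ring. -/
def flip (B : Type*) [Ring B] [StarRing B] : ℤˣ →* unitary (CStarMatrix (Fin 2) (Fin 2) B) where
  toFun s := ⟨if s = 1 then 1 else CStarMatrix.ofMatrix !![0, 1; 1, 0], by
    rw [Unitary.mem_iff]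
    split_ifs
    · simp
    · constructor <;> ext i j <;> fin_cases i <;> fin_cases j <;>
        simp [CStarMatrix.mul_apply, CStarMatrix.star_apply]⟩
  map_one' := by simp
  map_mul' s t := by
    apply Subtype.ext
    rcases Int.units_eq_one_or s with rfl | rfl <;> rcases Int.units_eq_one_or t with rfl | rfl <;>
      ext i j <;> fin_cases i <;> fin_cases j <;>
        simp [CStarMatrix.mul_apply]

/-- The representation `a ↦ diag(a, α₋₁(a))` of `A` by `2 × 2` matrices over its unitization. -/
def diag (α : ℤˣ →* (A ≃⋆ₐ[ℂ] A)) :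
    A →⋆ₙₐ[ℂ] CStarMatrix (Fin 2) (Fin 2) (Unitization ℂ A) where
  toFun a := CStarMatrix.ofMatrix !![(a : Unitization ℂ A), 0; 0, (α (-1) a : A)]
  map_smul' c a := by ext i j : 1; fin_cases i <;> fin_cases j <;> simp
  map_zero' := by ext i j : 1; fin_cases i <;> fin_cases j <;> simp
  map_add' a b := by ext i j : 1; fin_cases i <;> fin_cases j <;> simp
  map_mul' a b := by ext i j : 1; fin_cases i <;> fin_cases j <;> simp [CStarMatrix.mul_apply]
  map_star' a := by
    ext i j : 1; fin_cases i <;> fin_cases j <;> simp [CStarMatrix.star_apply, map_star]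

/-- Conjugation by the flip swaps the two diagonal entries, and so does replacing `a` by `α₋₁(a)`,
since `α₋₁` is an involution. -/
lemma diag_covariant (α : ℤˣ →* (A ≃⋆ₐ[ℂ] A)) (s : ℤˣ) (a : A) :
    diag α (α s a) = (flip (Unitization ℂ A) s : CStarMatrix (Fin 2) (Fin 2) (Unitization ℂ A)) *
      diag α a * star (flip (Unitization ℂ A) s : CStarMatrix (Fin 2) (Fin 2) _) := by
  rcases Int.units_eq_one_or s with rfl | rfl
  · simp
  · ext i j : 1
    fin_cases i <;> fin_cases j <;>
      simp [diag, flip, CStarMatrix.mul_apply, CStarMatrix.star_apply, act_act]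

/-- A unital representation of the `2 × 2` matrices over the unitization of `A` induces a covariant
representation of `A`. -/
def CovRep.ofStarAlgHom (α : ℤˣ →* (A ≃⋆ₐ[ℂ] A)) {H : Type u} [NormedAddCommGroup H]
    [InnerProductSpace ℂ H] [CompleteSpace H]
    (σ : CStarMatrix (Fin 2) (Fin 2) (Unitization ℂ A) →⋆ₐ[ℂ] (H →L[ℂ] H)) : CovRep α where
  H := H
  π := (σ : CStarMatrix (Fin 2) (Fin 2) (Unitization ℂ A) →⋆ₙₐ[ℂ] (H →L[ℂ] H)).comp (diag α)
  U :=
    (Unitary.map (StarMonoidHom.ofClass σ)).toMonoidHom.comp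
      (flip (Unitization ℂ A))
  covariant s a := by
    change σ (diag α (α s a)) = σ _ * σ (diag α a) * star (σ _)
    rw [diag_covariant, map_mul, map_mul, map_star]

lemma CovRep.integratedForm_ofStarAlgHom (α : ℤˣ →* (A ≃⋆ₐ[ℂ] A)) {H : Type u}
    [NormedAddCommGroup H] [InnerProductSpace ℂ H] [CompleteSpace H]
    (σ : CStarMatrix (Fin 2) (Fin 2) (Unitization ℂ A) →⋆ₐ[ℂ] (H →L[ℂ] H)) (f : ConvAlg α) :
    (CovRep.ofStarAlgHom α σ).integratedForm f = σ ((1 / 2 : ℂ) • CStarMatrix.ofMatrix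
      !![(f 1 : Unitization ℂ A), (f (-1) : A); (α (-1) (f (-1)) : A), (α (-1) (f 1) : A)]) := by
  have h : (CStarMatrix.ofMatrix
      !![(f 1 : Unitization ℂ A), (f (-1) : A); (α (-1) (f (-1)) : A), (α (-1) (f 1) : A)]) =
      ∑ s, diag α (f s) * (flip (Unitization ℂ A) s : CStarMatrix (Fin 2) (Fin 2) _) := by
    rw [sum_units]
    ext i j : 1
    fin_cases i <;> fin_cases j <;>
      simp [diag, flip, CStarMatrix.mul_apply]
  rw [h, map_smul, map_sum, CovRep.integratedForm_apply]
  simp only [map_mul]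
  rfl

/-! ### Equivalence of the universal and supremum norms -/

namespace ConvAlg

variable {α : ℤˣ →* (A ≃⋆ₐ[ℂ] A)}

/-- The universal norm dominates the norms of the values. -/
lemma norm_apply_le (f : ConvAlg α) (s : ℤˣ) : ‖f s‖ ≤ 2 * ‖f‖ := by
  let _ : PartialOrder (Unitization ℂ A) := CStarAlgebra.spectralOrder _
  have : StarOrderedRing (Unitization ℂ A) := CStarAlgebra.spectralOrderedRing _
  let X : CStarMatrix (Fin 2) (Fin 2) (Unitization ℂ A) := CStarMatrix.ofMatrix
    !![(f 1 : Unitization ℂ A), (f (-1) : A); (α (-1) (f (-1)) : A), (α (-1) (f 1) : A)]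
  obtain ⟨H, _, _, _, σ, hσ⟩ := CStarAlgebra.exists_starAlgHom_norm_le ((1 / 2 : ℂ) • X)
  have h1 : ‖f s‖ ≤ ‖X‖ := by
    rcases Int.units_eq_one_or s with rfl | rfl
    · simpa [X, Unitization.norm_inr] using
        CStarMatrix.norm_entry_le_norm (M := X) (i := 0) (j := 0)
    · simpa [X, Unitization.norm_inr] using
        CStarMatrix.norm_entry_le_norm (M := X) (i := 0) (j := 1)
  -- The Haar weight `1/2` here is the source of the constant `2` in the bound.
  have h2 : ‖(1 / 2 : ℂ) • X‖ ≤ ‖f‖ := by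
    refine hσ.trans ?_
    rw [← CovRep.integratedForm_ofStarAlgHom]
    exact le_univNorm _ f
  rw [norm_smul] at h2
  norm_num at h2
  linarith

lemma norm_le_sum (f : ConvAlg α) : ‖f‖ ≤ (1 / 2 : ℝ) * ∑ s : ℤˣ, ‖f s‖ :=
  univNorm_le (by positivity) fun ρ => ρ.norm_integratedForm_le f

/-- The identity map from `A^{ℤ₂}` with the universal norm to the functions `ℤ₂ → A` with the
supremum norm. -/
def toPi : ConvAlg α ≃ₗ[ℂ] (ℤˣ → A) := LinearEquiv.refl ℂ _

/-- The two norm estimates make the identity Lipschitz in both directions, so completeness passes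
from `ℤˣ → A` to the universal norm. -/
lemma isUniformInducing_toPi : IsUniformInducing (toPi : ConvAlg α → ℤˣ → A) := by
  have h1 : LipschitzWith 2 (toPi : ConvAlg α → ℤˣ → A) := by
    refine AddMonoidHomClass.lipschitz_of_bound_nnnorm (toPi (α := α)) 2 fun f => ?_
    rw [← NNReal.coe_le_coe]
    exact (pi_norm_le_iff_of_nonneg (by positivity)).mpr (norm_apply_le f)
  have h2 : AntilipschitzWith 1 (toPi : ConvAlg α → ℤˣ → A) := by
    refine AddMonoidHomClass.antilipschitz_of_bound (toPi (α := α)) fun f => ?_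
    have h3 := norm_le_sum f
    rw [sum_units] at h3
    have h4 (s : ℤˣ) : ‖f s‖ ≤ ‖toPi f‖ := norm_le_pi_norm (toPi f) s
    have := h4 1
    have := h4 (-1)
    simp only [NNReal.coe_one, one_mul]
    linarith
  exact h2.isUniformInducing h1.uniformContinuous

instance instCompleteSpace : CompleteSpace (ConvAlg α) :=
  (isUniformInducing_toPi.completeSpace_congr toPi.surjective).mpr inferInstance

end ConvAlg

/-! ### The *-isomorphisms -/

variable (α : ℤˣ →* (A ≃⋆ₐ[ℂ] A))

/-- The canonical map `A^{ℤ₂} → A ⋊_α ℤ₂` is a *-isomorphism. -/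
def convAlgEquivCrossedProduct : ConvAlg α ≃⋆ₐ[ℂ] CrossedProduct α :=
  StarAlgEquiv.ofBijective
    ({ toFun := CrossedProduct.ι
       map_smul' := CrossedProduct.ι.map_smul
       map_zero' := CrossedProduct.ι.map_zero
       map_add' := CrossedProduct.ι.map_add
       map_mul' := CrossedProduct.ι_mul
       map_star' := CrossedProduct.ι_star } : ConvAlg α →⋆ₙₐ[ℂ] CrossedProduct α) <| by
    constructor
    · intro f g h
      change CrossedProduct.ι f = CrossedProduct.ι g at h
      -- A priori `ι` kills the null space of a seminorm; `norm_apply_le` shows that this space is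
      -- zero.
      have h0 : ‖f - g‖ = 0 := by
        rw [← (CrossedProduct.ι (α := α)).norm_map, map_sub, h, sub_self, norm_zero]
      ext s
      have := ConvAlg.norm_apply_le (f - g) s
      rw [h0, mul_zero] at this
      exact sub_eq_zero.mp (norm_le_zero_iff.mp this)
    -- The isometric image of a complete space is closed, and the image of `ι` is dense.
    · have h : IsClosed (Set.range (CrossedProduct.ι (α := α))) :=
        CrossedProduct.ι.isometry.isUniformInducing.isComplete_range.isClosed
      intro x
      exact h.closure_eq.subset (CrossedProduct.denseRange_ι x)

/-- The *-isomorphism `f ↦ ½ [[f(1), f(-1)], [α₋₁(f(-1)), α₋₁(f(1))]]` from `A^{ℤ₂}` onto `Â`. -/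
def convAlgEquivHatAlg : ConvAlg α ≃⋆ₐ[ℂ] hatAlg α :=
  StarAlgEquiv.ofBijective
    -- With the factor `1/2`, matrix multiplication reproduces the convolution normalized by `1/2`.
    ({ toFun := fun f => ⟨CStarMatrix.ofMatrix !![(1 / 2 : ℂ) • f 1, (1 / 2 : ℂ) • f (-1);
          α (-1) ((1 / 2 : ℂ) • f (-1)), α (-1) ((1 / 2 : ℂ) • f 1)], _, _, rfl⟩
       map_smul' := fun c f => by
        apply Subtype.ext
        ext i j
        fin_cases i <;> fin_cases j <;> simp [smul_comm c]
       map_zero' := by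
        apply Subtype.ext
        ext i j
        fin_cases i <;> fin_cases j <;> simp
       map_add' := fun f g => by
        apply Subtype.ext
        ext i j
        fin_cases i <;> fin_cases j <;> simp
       map_mul' := fun f g => by
        apply Subtype.ext
        ext i j
        fin_cases i <;> fin_cases j <;>
          simp [CStarMatrix.mul_apply, ConvAlg.mul_apply, act_act, smul_smul,
            smul_mul_assoc, mul_smul_comm, add_comm]
       map_star' := fun f => by
        apply Subtype.ext
        ext i j
        fin_cases i <;> fin_cases j <;>
          simp [CStarMatrix.star_apply, ConvAlg.star_apply, act_act,
            ← map_star] } :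
      ConvAlg α →⋆ₙₐ[ℂ] hatAlg α) <| by
    constructor
    · intro f g h
      have h' (i j : Fin 2) := congrFun (congrFun (congrArg Subtype.val h) i) j
      ext s
      rcases Int.units_eq_one_or s with rfl | rfl
      · simpa using h' 0 0
      · simpa using h' 0 1
    · rintro ⟨_, a, b, rfl⟩
      refine ⟨fun s => (2 : ℂ) • if s = 1 then a else b, Subtype.ext ?_⟩
      ext i j
      fin_cases i <;> fin_cases j <;> simp [smul_smul]

end Z2Crossed

end

theorem mainTheorem4 {A : Type u} [NonUnitalCStarAlgebra A]
    (α : ℤˣ →* (A ≃⋆ₐ[ℂ] A)) :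
    (∀ (B : Type v) [NonUnitalCStarAlgebra B],
      Nonempty (B ≃⋆ₐ[ℂ] Z2Crossed.ConvAlg α) →
        Nonempty (Z2Crossed.CrossedProduct α ≃⋆ₐ[ℂ] B)) ∧
    Nonempty (Z2Crossed.CrossedProduct α ≃⋆ₐ[ℂ] Z2Crossed.hatAlg α) := by
  refine ⟨fun B _ ⟨e⟩ => ⟨?_⟩, ⟨?_⟩⟩
  · exact (Z2Crossed.convAlgEquivCrossedProduct α).symm.trans e.symm
  · exact (Z2Crossed.convAlgEquivCrossedProduct α).symm.trans (Z2Crossed.convAlgEquivHatAlg α)
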